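/- Setting. Let $1<m<n$. Let $F$ be a Finsler fundamental function over a coordinate domain $U\subseteq\mathbb R^n$ of an $n$-manifold $M$ ($F\ge 0$, smooth for $y^{(1)}\ne0$, positively $1$-homogeneous in $y^{(1)}$, with $g_{ab}=\frac12\frac{\partial^2F^2}{\partial y^{(1)a}\partial y^{(1)b}}$ positive definite for $y^{(1)}\neq 0$), with coordinates $(x,y^{(1)},y^{(2)})$ on $Osc^2M$. Give $Osc^2M$ the nonlinear connection with dual coefficients $\underset{(1)}M{}^a_b=\partial G^a/\partial y^{(1)b}$ and $\underset{(2)}M{}^a_b=\frac12(\Gamma \underset{(1)}M{}^a_b+\underset{(1)}M{}^a_d\underset{(1)}M{}^d_b)$, where $G^a=\frac12\gamma^a_{bc}y^{(1)b}y^{(1)c}$, $\gamma^a_{bc}=\frac12g^{ad}\left(\frac{\partial g_{dc}}{\partial x^b}+\frac{\partial g_{bd}}{\partial x^c}-\frac{\partial g_{bc}}{\partial x^d}\right)$ and $\Gamma=y^{(1)a}\frac{\partial}{\partial x^a}+2y^{(2)a}\frac{\partial}{\partial y^{(1)a}}$; its adapted cobasis is $dx$, $\delta y^{(1)}=dy^{(1)}+\underset{(1)}M\,dx$,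 $\delta y^{(2)}=dy^{(2)}+\underset{(1)}M\,dy^{(1)}+\underset{(2)}M\,dx$, with dual basis $\delta_{0a},\delta_{1a},\delta_{2a}$. Let $B^a_{(jj)cb}$ be the $\delta_{ja}$-component of $[\delta_{0c},\delta_{jb}]$. The canonical metrical $N$-linear connection has coefficients (write $L_{(i0)}=C_{(i0)}$) $$C^a_{(ii)bc}=\tfrac12g^{ad}(\delta_{ib}g_{dc}+\delta_{ic}g_{bd}-\delta_{id}g_{bc})\ (i=0,1,2),\qquad C^a_{(ik)bc}=\tfrac12g^{ad}\delta_{kc}g_{bd}\ (k=1,2,\ i\ne k),$$ $$L^a_{(j0)bc}=B^a_{(jj)cb}+\tfrac12g^{ad}\big(\delta_{0c}g_{bd}-B^f_{(jj)cb}g_{fd}-B^f_{(jj)cd}g_{bf}\big)\ (j=1,2).$$ Let $x=x(u)$, $u\in V\subseteq\mathbb R^m$ open, be a smooth immersion into $U$ (a submanifold $\check M$ of $M$ in a chart), $B^a_\alpha=\partial x^a/\partial u^\alpha$, $B^a_{\alpha\beta}=\partial B^a_\alpha/\partial u^\beta$; let $(u,v^{(1)},v^{(2)})$ be the coordinates on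 $Osc^2\check M$ and $Osc^2\check M\to Osc^2M$ the induced immersion $y^{(1)a}=B^a_\alpha v^{(1)\alpha}$, $2y^{(2)a}=B^a_{\alpha\beta}v^{(1)\alpha}v^{(1)\beta}+2B^a_\alpha v^{(2)\alpha}$. Let $W$ be an open set of points with $u\in V$, $v^{(1)}\ne0$, on which a smooth $g$-orthonormal frame $B^a_{\bar\alpha}$ ($\bar\alpha=1,\dots,n-m$) of normal d-vectors is given, and let $(B^\alpha_a,B^{\bar\alpha}_a)$ be the frame dual to $(B^a_\alpha,B^a_{\bar\alpha})$. The induced nonlinear connection $\check N$ is the one whose adapted cobasis is $du^\alpha$, $\delta v^{(1)\alpha}=B^\alpha_a\delta y^{(1)a}$, $\delta v^{(2)\alpha}=B^\alpha_a\delta y^{(2)a}$; $\check M_{(1)},\check M_{(2)}$ are its dual coefficients, and $\delta_{0\alpha},\delta_{1\alpha},\delta_{2\alpha}$ now denotes its adapted basis. With $K_{(j)}{}^{\bar\alpha}_\beta=B^{\bar\alpha}_a\,\delta y^{(j)a}(\delta_{0\beta})$ put $$\check L^a_{(i0)b\delta}=L^a_{(i0)bd}B^d_\delta+C^a_{(i1)bd}B^d_{\bar\delta}K_{(1)}{}^{\bar\delta}_\delta+C^a_{(i2)bd}B^d_{\bar\delta}K_{(2)}{}^{\bar\delta}_\delta,\quad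 \check C^a_{(i1)b\delta}=C^a_{(i1)bd}B^d_\delta+C^a_{(i2)bd}B^d_{\bar\delta}K_{(1)}{}^{\bar\delta}_\delta,\quad \check C^a_{(i2)b\delta}=C^a_{(i2)bd}B^d_\delta .$$ The induced tangent $N$-linear connection has coefficients $$L^\alpha_{(i0)\beta\delta}=B^\alpha_d(B^d_{\beta\delta}+B^f_\beta\check L^d_{(i0)f\delta}),\qquad C^\alpha_{(ik)\beta\delta}=B^\alpha_dB^f_\beta\check C^d_{(ik)f\delta}\quad(k=1,2).$$ For a d-vector field $X^\alpha$ put $X^\alpha{}_{|i\beta}=\delta_{0\beta}X^\alpha+X^\gamma L^\alpha_{(i0)\gamma\beta}$ and $X^\alpha\overset{(k)}{|}{}_{i\beta}=\delta_{k\beta}X^\alpha+X^\gamma C^\alpha_{(ik)\gamma\beta}$ ($k=1,2$). The Liouville d-vector fields are $z^{(1)\alpha}=v^{(1)\alpha}$ and $z^{(2)\alpha}=v^{(2)\alpha}+\frac12\check M_{(1)}{}^\alpha_\beta v^{(1)\beta}$. Write $[\delta_{k\beta},\delta_{l\gamma}]=\sum_hA_{kl}^{h}{}^\sigma_{\beta\gamma}\delta_{h\sigma}$.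 The torsion d-tensors are $$\underset{(0j)}R{}^\sigma_{\beta\gamma}=A^j_{00}{}^\sigma_{\beta\gamma},\quad \underset{(12)}R{}^\sigma_{\beta\gamma}=A^2_{11}{}^\sigma_{\beta\gamma},\quad \underset{(12)}P{}^\sigma_{\beta\gamma}=A^2_{01}{}^\sigma_{\beta\gamma},\quad \underset{(21)}P{}^\sigma_{\beta\gamma}=A^1_{02}{}^\sigma_{\beta\gamma},$$ $$\overset{(i)}{\underset{(jj)}P}{}^\sigma_{\beta\gamma}=A^j_{0j}{}^\sigma_{\beta\gamma}-L^\sigma_{(i0)\gamma\beta},\quad \overset{(i)}{\underset{(22)}Q}{}^\sigma_{\beta\gamma}=A^2_{12}{}^\sigma_{\beta\gamma}-C^\sigma_{(i1)\gamma\beta},\quad \overset{(i)}{\underset{(j)}S}{}^\sigma_{\beta\gamma}=C^\sigma_{(ij)\beta\gamma}-C^\sigma_{(ij)\gamma\beta}.$$ Writing $C_{(i0)}$ for $L_{(i0)}$, put $$\mathcal R_{kl}{}_\delta{}^\alpha{}_{\beta\gamma}=\delta_{l\gamma}C^\alpha_{(ik)\delta\beta}-\delta_{k\beta}C^\alpha_{(il)\delta\gamma}+C^\varepsilon_{(ik)\delta\beta}C^\alpha_{(il)\varepsilon\gamma}-C^\varepsilon_{(il)\delta\gamma}C^\alpha_{(ik)\varepsilon\beta}+\sum_hC^\alpha_{(ih)\delta\sigma}A^h_{kl}{}^\sigma_{\beta\gamma};$$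 the curvature d-tensors are $\underset{(0i)}R=\mathcal R_{00}$, $\underset{(ji)}P=\mathcal R_{0j}$, $\underset{(2i)}Q=\mathcal R_{12}$, $\underset{(ji)}S=\mathcal R_{jj}$ ($j=1,2$). Proposition 5.2. Let $i\in\{0,1,2\}$ and suppose that on $W$ the deflection tensors satisfy $$z^{(1)\alpha}{}_{|i\beta}=0,\quad z^{(1)\alpha}\overset{(1)}{|}{}_{i\beta}=\delta^\alpha_\beta,\quad z^{(1)\alpha}\overset{(2)}{|}{}_{i\beta}=0,\quad z^{(2)\alpha}{}_{|i\beta}=0,\quad z^{(2)\alpha}\overset{(1)}{|}{}_{i\beta}=0,\quad z^{(2)\alpha}\overset{(2)}{|}{}_{i\beta}=\delta^\alpha_\beta .$$ Then, on $W$ and for $j=1,2$ (no summation over $i$, $j$), $$z^{(j)\delta}\underset{(0i)}R{}_\delta{}^\alpha{}_{\beta\gamma}=\underset{(0j)}R{}^\alpha_{\beta\gamma},\quad z^{(1)\delta}\underset{(2i)}P{}_\delta{}^\alpha{}_{\beta\gamma}=\underset{(21)}P{}^\alpha_{\beta\gamma},\quad z^{(2)\delta}\underset{(1i)}P{}_\delta{}^\alpha{}_{\beta\gamma}=\underset{(12)}P{}^\alpha_{\beta\gamma},$$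 $$z^{(j)\delta}\underset{(ji)}P{}_\delta{}^\alpha{}_{\beta\gamma}=\overset{(i)}{\underset{(jj)}P}{}^\alpha_{\beta\gamma},\quad z^{(1)\delta}\underset{(2i)}Q{}_\delta{}^\alpha{}_{\beta\gamma}=C^\alpha_{(i2)\beta\gamma},\quad z^{(2)\delta}\underset{(2i)}Q{}_\delta{}^\alpha{}_{\beta\gamma}=\overset{(i)}{\underset{(22)}Q}{}^\alpha_{\beta\gamma},$$ $$z^{(j)\delta}\underset{(ji)}S{}_\delta{}^\alpha{}_{\beta\gamma}=\overset{(i)}{\underset{(j)}S}{}^\alpha_{\beta\gamma},\quad z^{(1)\delta}\underset{(2i)}S{}_\delta{}^\alpha{}_{\beta\gamma}=0,\quad z^{(2)\delta}\underset{(1i)}S{}_\delta{}^\alpha{}_{\beta\gamma}=\underset{(12)}R{}^\alpha_{\beta\gamma}.$$ -/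

import Mathlib

open scoped ContDiff

noncomputable section

/-!
Local coordinate expressions for the second order osculator bundle.  A point of the osculator
bundle over a chart domain of an `n`-dimensional manifold is `p : Osc2.Coord n`, where
`p 0 = x`, `p 1 = y⁽¹⁾` and `p 2 = y⁽²⁾`.
-/

namespace Osc2

/-- Coordinates `(x, y⁽¹⁾, y⁽²⁾)`; also the model of the tangent spaces. -/
abbrev Coord (n : ℕ) : Type := Fin 3 → Fin n → ℝ

/-- The natural frame: `∂/∂xᵃ` for `k = 0`, and `∂/∂y⁽ᵏ⁾ᵃ` for `k = 1, 2`. -/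
def natFrame {n : ℕ} (k : Fin 3) (a : Fin n) : Coord n := Pi.single k (Pi.single a 1)

/-- The partial derivative in the natural direction `(k, a)`. -/
def pd {n : ℕ} (k : Fin 3) (a : Fin n) (f : Coord n → ℝ) (p : Coord n) : ℝ :=
  fderiv ℝ f p (natFrame k a)

/-! ### Nonlinear connections -/

/-- The dual coefficients `M₍₁₎ᵃ_b` and `M₍₂₎ᵃ_b` (upper index first) of a nonlinear connection. -/
structure NonlinConn (n : ℕ) where
  /-- The first dual coefficients. -/
  M1 : Coord n → Fin n → Fin n → ℝ
  /-- The second dual coefficients. -/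
  M2 : Coord n → Fin n → Fin n → ℝ

namespace NonlinConn

variable {n : ℕ} (N : NonlinConn n)

/-- The adapted cobasis `dx`, `δy⁽¹⁾ = dy⁽¹⁾ + M₍₁₎ dx`, `δy⁽²⁾ = dy⁽²⁾ + M₍₁₎ dy⁽¹⁾ + M₍₂₎ dx`,
evaluated at `p` on the tangent vector `w`. -/
def coframe (k : Fin 3) (a : Fin n) (p w : Coord n) : ℝ :=
  match k with
  | 0 => w 0 a
  | 1 => w 1 a + ∑ b, N.M1 p a b * w 0 b
  | 2 => w 2 a + ∑ b, N.M1 p a b * w 1 b + ∑ b, N.M2 p a b * w 0 b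

/-- The adapted basis `δ/δxᵃ`, `δ/δy⁽¹⁾ᵃ`, `δ/δy⁽²⁾ᵃ = ∂/∂y⁽²⁾ᵃ`, for `k = 0, 1, 2`.  It is the
basis dual to the adapted cobasis, see `coframe_frame`. -/
def frame (k : Fin 3) (a : Fin n) (p : Coord n) : Coord n :=
  match k with
  | 0 => ![Pi.single a 1, fun b => -N.M1 p b a,
      fun b => (∑ c, N.M1 p b c * N.M1 p c a) - N.M2 p b a]
  | 1 => ![0, Pi.single a 1, fun b => -N.M1 p b a]
  | 2 => ![0, 0, Pi.single a 1]

theorem coframe_frame (k l : Fin 3) (a b : Fin n) (p : Coord n) :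
    N.coframe k a p (N.frame l b p) = if k = l ∧ a = b then 1 else 0 := by
  fin_cases k <;> fin_cases l <;>
    simp [coframe, frame, Pi.single_apply, sub_add_eq_add_sub]

/-- The derivative of a function along the adapted basis vector field `(k, a)`. -/
def fd (k : Fin 3) (a : Fin n) (f : Coord n → ℝ) (p : Coord n) : ℝ :=
  fderiv ℝ f p (N.frame k a p)

/-- The component along the adapted basis field `(c, s)` of the Lie bracket of the adapted basis
fields `(k, a)` and `(l, b)`. -/
def bracketCoef (c k l : Fin 3) (s a b : Fin n) (p : Coord n) : ℝ :=
  N.coframe c s p (VectorField.lieBracket ℝ (N.frame k a) (N.frame l b) p)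

end NonlinConn

/-! ### N-linear connections, their torsion and curvature d-tensors -/

/-- The nine coefficients of an N-linear connection.  For `Γ : LinConn n`, `Γ i 0 a b d` is
`L₍ᵢ₀₎ᵃ_{bd}` and, for `k = 1, 2`, `Γ i k a b d` is `C₍ᵢₖ₎ᵃ_{bd}`; here `i` is the distribution on
which the connection acts, `d` the index of differentiation, and
`D_{δ_{k,d}} δ_{i,b} = Γ i k a b d • δ_{i,a}`. -/
abbrev LinConn (n : ℕ) : Type := Fin 3 → Fin 3 → Fin n → Fin n → Fin n → Coord n → ℝ

/-- The covariant derivatives of a d-vector field `X`: the `hᵢ`-covariant derivative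
`Xᵃ_{|ib}` for `k = 0` and the `v_{ki}`-covariant derivative `Xᵃ|⁽ᵏ⁾_{ib}` for `k = 1, 2`. -/
def covDeriv {n : ℕ} (N : NonlinConn n) (Γ : LinConn n) (i k : Fin 3)
    (X : Fin n → Coord n → ℝ) (a b : Fin n) (p : Coord n) : ℝ :=
  N.fd k b (X a) p + ∑ c, X c p * Γ i k a c b p

section Tensors

variable {n : ℕ} (N : NonlinConn n) (Γ : LinConn n)

/-- The torsion d-tensors `R₍₀₁₎`, `R₍₀₂₎` (`j = 1, 2`), the curvature of the nonlinear connection: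
`[δ_b, δ_c] = R₍₀₁₎ˢ_{bc} δ_{1s} + R₍₀₂₎ˢ_{bc} δ_{2s}`. -/
def torsR0 (j : Fin 3) (s b c : Fin n) (p : Coord n) : ℝ := N.bracketCoef j 0 0 s b c p

/-- The torsion d-tensor `R₍₁₂₎`: `[δ_{1b}, δ_{1c}] = R₍₁₂₎ˢ_{bc} δ_{2s}`. -/
def torsR12 (s b c : Fin n) (p : Coord n) : ℝ := N.bracketCoef 2 1 1 s b c p

/-- The torsion d-tensor `P₍₁₂₎`: the `δ_{2s}`-component of `[δ_b, δ_{1c}]`. -/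
def torsP12 (s b c : Fin n) (p : Coord n) : ℝ := N.bracketCoef 2 0 1 s b c p

/-- The torsion d-tensor `P₍₂₁₎`: the `δ_{1s}`-component of `[δ_b, δ_{2c}]`. -/
def torsP21 (s b c : Fin n) (p : Coord n) : ℝ := N.bracketCoef 1 0 2 s b c p

/-- The torsion d-tensors `P₍₁₁₎⁽ⁱ⁾` and `P₍₂₂₎⁽ⁱ⁾` (`j = 1, 2`): the `δ_{js}`-component of
`[δ_b, δ_{jc}]`, minus `L₍ᵢ₀₎ˢ_{cb}`. -/
def torsP (j i : Fin 3) (s b c : Fin n) (p : Coord n) : ℝ :=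
  N.bracketCoef j 0 j s b c p - Γ i 0 s c b p

/-- The torsion d-tensor `Q₍₂₂₎⁽ⁱ⁾`: the `δ_{2s}`-component of `[δ_{1b}, δ_{2c}]`, minus
`C₍ᵢ₁₎ˢ_{cb}`. -/
def torsQ22 (i : Fin 3) (s b c : Fin n) (p : Coord n) : ℝ :=
  N.bracketCoef 2 1 2 s b c p - Γ i 1 s c b p

/-- The torsion d-tensors `S₍ⱼ₎⁽ⁱ⁾ˢ_{bc} = C₍ᵢⱼ₎ˢ_{bc} - C₍ᵢⱼ₎ˢ_{cb}`, `j = 1, 2`. -/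
def torsS (j i : Fin 3) (s b c : Fin n) (p : Coord n) : ℝ := Γ i j s b c p - Γ i j s c b p

/-- The components of the curvature `R(X, Y) Z = D_X D_Y Z - D_Y D_X Z - D_{[X,Y]} Z` of the
N-linear connection on the `i`-th distribution:
`R(δ_{lc}, δ_{kb}) δ_{id} = (curv N Γ i k l d a b c) • δ_{ia}`. -/
def curv (i k l : Fin 3) (d a b c : Fin n) (p : Coord n) : ℝ :=
  N.fd l c (Γ i k a d b) p - N.fd k b (Γ i l a d c) p
    + ∑ e, Γ i k e d b p * Γ i l a e c p - ∑ e, Γ i l e d c p * Γ i k a e b p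
    + ∑ h, ∑ s, Γ i h a d s p * N.bracketCoef h k l s b c p

/-- The curvature d-tensors `R₍₀ᵢ₎ d ᵃ bc`. -/
def curvR (i : Fin 3) (d a b c : Fin n) (p : Coord n) : ℝ := curv N Γ i 0 0 d a b c p

/-- The curvature d-tensors `P₍ⱼᵢ₎ d ᵃ bc`, `j = 1, 2`. -/
def curvP (j i : Fin 3) (d a b c : Fin n) (p : Coord n) : ℝ := curv N Γ i 0 j d a b c p

/-- The curvature d-tensors `Q₍₂ᵢ₎ d ᵃ bc`. -/
def curvQ (i : Fin 3) (d a b c : Fin n) (p : Coord n) : ℝ := curv N Γ i 1 2 d a b c p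

/-- The curvature d-tensors `S₍ⱼᵢ₎ d ᵃ bc`, `j = 1, 2`. -/
def curvS (j i : Fin 3) (d a b c : Fin n) (p : Coord n) : ℝ := curv N Γ i j j d a b c p

end Tensors

/-- The Liouville d-vector field `z⁽¹⁾ = v⁽¹⁾`. -/
def z1 {n : ℕ} (a : Fin n) (p : Coord n) : ℝ := p 1 a

/-- The Liouville d-vector field `z⁽²⁾ = v⁽²⁾ + (1/2) M₍₁₎ v⁽¹⁾`. -/
def z2 {n : ℕ} (N : NonlinConn n) (a : Fin n) (p : Coord n) : ℝ :=
  p 2 a + 1 / 2 * ∑ b, N.M1 p a b * p 1 b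

/-! ### The Finsler space and its canonical connections -/

section Finsler

variable {n : ℕ} (F : (Fin n → ℝ) → (Fin n → ℝ) → ℝ)

/-- The fundamental tensor `g_{ab} = (1/2) ∂²F²/∂y⁽¹⁾ᵃ∂y⁽¹⁾ᵇ`, as a function on the osculator
bundle. -/
def fundTensor (p : Coord n) : Matrix (Fin n) (Fin n) ℝ :=
  Matrix.of fun a b => 1 / 2 * pd 1 a (pd 1 b fun q => F (q 0) (q 1) ^ 2) p

/-- `F` is a Finsler fundamental function over the chart domain `U`. -/
structure IsFinsler (U : Set (Fin n → ℝ)) : Prop where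
  nonneg : ∀ x ∈ U, ∀ y, 0 ≤ F x y
  smooth : ContDiffOn ℝ ∞ (fun q : (Fin n → ℝ) × (Fin n → ℝ) => F q.1 q.2)
    {q | q.1 ∈ U ∧ q.2 ≠ 0}
  homogeneous : ∀ x ∈ U, ∀ y, ∀ t : ℝ, 0 < t → F x (t • y) = t * F x y
  posDef : ∀ p : Coord n, p 0 ∈ U → p 1 ≠ 0 → (fundTensor F p).PosDef

/-- The Christoffel symbols `γᵃ_{bc}` of the fundamental tensor. -/
def christoffel (a b c : Fin n) (p : Coord n) : ℝ :=
  1 / 2 * ∑ d, (fundTensor F p)⁻¹ a d *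
    (pd 0 b (fun q => fundTensor F q d c) p + pd 0 c (fun q => fundTensor F q b d) p
      - pd 0 d (fun q => fundTensor F q b c) p)

/-- `Gᵃ = (1/2) γᵃ_{bc} y⁽¹⁾ᵇ y⁽¹⁾ᶜ`. -/
def spray (a : Fin n) (p : Coord n) : ℝ :=
  1 / 2 * ∑ b, ∑ c, christoffel F a b c p * p 1 b * p 1 c

/-- `M₍₁₎ᵃ_b = ∂Gᵃ/∂y⁽¹⁾ᵇ`. -/
def canM1 (p : Coord n) (a b : Fin n) : ℝ := pd 1 b (spray F a) p

/-- The operator `Γ = y⁽¹⁾ᵃ ∂/∂xᵃ + 2 y⁽²⁾ᵃ ∂/∂y⁽¹⁾ᵃ`. -/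
def gammaOp (f : Coord n → ℝ) (p : Coord n) : ℝ :=
  ∑ a, (p 1 a * pd 0 a f p + 2 * p 2 a * pd 1 a f p)

/-- `M₍₂₎ᵃ_b = (1/2) (Γ M₍₁₎ᵃ_b + M₍₁₎ᵃ_d M₍₁₎ᵈ_b)`. -/
def canM2 (p : Coord n) (a b : Fin n) : ℝ :=
  1 / 2 * (gammaOp (fun q => canM1 F q a b) p + ∑ d, canM1 F p a d * canM1 F p d b)

/-- The nonlinear connection determined by the fundamental tensor. -/
def canNonlin : NonlinConn n := ⟨canM1 F, canM2 F⟩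

/-- `(1/2) gᵃᵈ (δ_{kb} g_{dc} + δ_{kc} g_{bd} - δ_{kd} g_{bc})`. -/
def adaptedChristoffel (k : Fin 3) (a b c : Fin n) (p : Coord n) : ℝ :=
  1 / 2 * ∑ d, (fundTensor F p)⁻¹ a d *
    ((canNonlin F).fd k b (fun q => fundTensor F q d c) p
      + (canNonlin F).fd k c (fun q => fundTensor F q b d) p
      - (canNonlin F).fd k d (fun q => fundTensor F q b c) p)

/-- `B₍ⱼⱼ₎ᵃ_{cb}`, the `δ_{ja}`-component of `[δ_c, δ_{jb}]`. -/
def Bjj (j : Fin 3) (a c b : Fin n) (p : Coord n) : ℝ := (canNonlin F).bracketCoef j 0 j a c b p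

/-- The canonical metrical N-linear connection, with its nine coefficients. -/
def canLin : LinConn n := fun i k a b c p =>
  if i = k then
    -- the coefficients `L₍₀₀₎`, `C₍₁₁₎`, `C₍₂₂₎`
    adaptedChristoffel F k a b c p
  else if k = 0 then
    -- the coefficients `L₍₁₀₎`, `L₍₂₀₎`
    Bjj F i a c b p + 1 / 2 * ∑ d, (fundTensor F p)⁻¹ a d *
      ((canNonlin F).fd 0 c (fun q => fundTensor F q b d) p
        - ∑ f, Bjj F i f c b p * fundTensor F p f d - ∑ f, Bjj F i f c d p * fundTensor F p b f)
  else
    -- the coefficients `C₍₀₁₎`, `C₍₂₁₎`, `C₍₀₂₎`, `C₍₁₂₎`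
    1 / 2 * ∑ d, (fundTensor F p)⁻¹ a d * (canNonlin F).fd k c (fun q => fundTensor F q b d) p

end Finsler

/-! ### The submanifold and the induced objects -/

section Submanifold

variable {n m : ℕ}

/-- `Bᵃ_α = ∂xᵃ/∂uᵅ`. -/
def tanB (x : (Fin m → ℝ) → (Fin n → ℝ)) (a : Fin n) (α : Fin m) (u : Fin m → ℝ) : ℝ :=
  fderiv ℝ x u (Pi.single α 1) a

/-- `Bᵃ_{αβ} = ∂²xᵃ/∂uᵅ∂uᵝ`. -/
def tanB2 (x : (Fin m → ℝ) → (Fin n → ℝ)) (a : Fin n) (α β : Fin m) (u : Fin m → ℝ) : ℝ :=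
  fderiv ℝ (tanB x a α) u (Pi.single β 1)

/-- The immersion of osculator bundles induced by the immersion `x = x(u)`:
`y⁽¹⁾ᵃ = Bᵃ_α v⁽¹⁾ᵅ`, `2 y⁽²⁾ᵃ = Bᵃ_{αβ} v⁽¹⁾ᵅ v⁽¹⁾ᵝ + 2 Bᵃ_α v⁽²⁾ᵅ`. -/
def osc (x : (Fin m → ℝ) → (Fin n → ℝ)) (p : Coord m) : Coord n :=
  ![x (p 0), fun a => ∑ α, tanB x a α (p 0) * p 1 α,
    fun a => 1 / 2 * ∑ α, ∑ β, tanB2 x a α β (p 0) * p 1 α * p 1 β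
      + ∑ α, tanB x a α (p 0) * p 2 α]

variable (F : (Fin n → ℝ) → (Fin n → ℝ) → ℝ) (x : (Fin m → ℝ) → (Fin n → ℝ))

/-- The induced metric `g_{αβ} = g_{ab} Bᵃ_α Bᵇ_β`. -/
def indMetric (p : Coord m) : Matrix (Fin m) (Fin m) ℝ :=
  Matrix.of fun α β =>
    ∑ a, ∑ b, fundTensor F (osc x p) a b * tanB x a α (p 0) * tanB x b β (p 0)

/-- The tangential part `B_a^α = gᵅᵝ g_{ab} Bᵇ_β` of the dual moving frame. -/
def cotanB (α : Fin m) (a : Fin n) (p : Coord m) : ℝ :=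
  ∑ β, ∑ b, (indMetric F x p)⁻¹ α β * fundTensor F (osc x p) a b * tanB x b β (p 0)

/-- `E` (with `E ν a p = Bᵃ_ν`) is a smooth frame of `n - m` unit d-vector fields, on the set `W`,
which are normal to the submanifold and to each other. -/
structure IsNormalFrame (W : Set (Coord m)) (E : Fin (n - m) → Fin n → Coord m → ℝ) : Prop where
  smooth : ∀ ν a, ContDiffOn ℝ ∞ (E ν a) W
  normal : ∀ p ∈ W, ∀ α ν,
    ∑ a, ∑ b, fundTensor F (osc x p) a b * tanB x a α (p 0) * E ν b p = 0
  orthonormal : ∀ p ∈ W, ∀ μ ν,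
    ∑ a, ∑ b, fundTensor F (osc x p) a b * E μ a p * E ν b p = if μ = ν then 1 else 0

/-- The pullback to the osculator bundle of the submanifold of the adapted cobasis of the
canonical nonlinear connection, evaluated at `p` on the tangent vector `w`. -/
def pullCoframe (k : Fin 3) (a : Fin n) (p w : Coord m) : ℝ :=
  (canNonlin F).coframe k a (osc x p) (fderiv ℝ (osc x) p w)

/-- The induced nonlinear connection: the one with `δv⁽¹⁾ᵅ = B_a^α δy⁽¹⁾ᵃ` and
`δv⁽²⁾ᵅ = B_a^α δy⁽²⁾ᵃ`.  Its dual coefficients are the `duᵝ`-components of these forms. -/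
def indNonlin : NonlinConn m where
  M1 p α β := ∑ a, cotanB F x α a p * pullCoframe F x 1 a p (natFrame 0 β)
  M2 p α β := ∑ a, cotanB F x α a p * pullCoframe F x 2 a p (natFrame 0 β)

variable (E : Fin (n - m) → Fin n → Coord m → ℝ)

/-- The normal part `B_a^ν = g_{ab} Bᵇ_ν` of the dual moving frame. -/
def conormB (ν : Fin (n - m)) (a : Fin n) (p : Coord m) : ℝ :=
  ∑ b, fundTensor F (osc x p) a b * E ν b p

/-- The mixed d-tensors `K₍₁₎^ν_β`, `K₍₂₎^ν_β` (`j = 1, 2`): the coefficients of `B_ν duᵝ` in the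
restriction of `δy⁽ʲ⁾` to the submanifold, in terms of the induced adapted cobasis. -/
def mixedK (j : Fin 3) (ν : Fin (n - m)) (β : Fin m) (p : Coord m) : ℝ :=
  ∑ a, conormB F x E ν a p * pullCoframe F x j a p ((indNonlin F x).frame 0 β p)

/-- The nine coefficients of the coupling of the canonical metrical N-linear connection to the
induced nonlinear connection. -/
def coupling (i k : Fin 3) (a b : Fin n) (δ : Fin m) (p : Coord m) : ℝ :=
  match k with
  | 0 => ∑ d, canLin F i 0 a b d (osc x p) * tanB x d δ (p 0)
      + ∑ d, ∑ ν, canLin F i 1 a b d (osc x p) * E ν d p * mixedK F x E 1 ν δ p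
      + ∑ d, ∑ ν, canLin F i 2 a b d (osc x p) * E ν d p * mixedK F x E 2 ν δ p
  | 1 => ∑ d, canLin F i 1 a b d (osc x p) * tanB x d δ (p 0)
      + ∑ d, ∑ ν, canLin F i 2 a b d (osc x p) * E ν d p * mixedK F x E 1 ν δ p
  | 2 => ∑ d, canLin F i 2 a b d (osc x p) * tanB x d δ (p 0)

/-- The induced tangent N-linear connection. -/
def indLin : LinConn m := fun i k α β δ p =>
  ∑ d, cotanB F x α d p *
    ((if k = 0 then tanB2 x d β δ (p 0) else 0)
      + ∑ f, tanB x f β (p 0) * coupling F x E i k d f δ p)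

end Submanifold

end Osc2

end

/-!
The identities are instances of the Ricci identity.  Let `z` be a d-vector field whose covariant
derivative in the direction of the `k`-th distribution is `cₖ δᵅ_β` with constants `cₖ`; for `z⁽¹⁾`
these are `(0, 1, 0)`, and for `z⁽²⁾` they are `(0, 0, 1)`.  Then
`δ_{kβ} zᵅ = cₖ δᵅ_β - z^δ C₍ᵢₖ₎ᵅ_{δβ}`.  Differentiating once more along the adapted frame,
antisymmetrizing, and expanding the commutator `[δ_{kβ}, δ_{lγ}]` in the adapted frame gives
`z^δ R_{kl δ}ᵅ_{βγ} = ∑ₕ cₕ Aʰ_{kl}ᵅ_{βγ} + cₖ C₍ᵢₗ₎ᵅ_{βγ} - cₗ C₍ᵢₖ₎ᵅ_{γβ}`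
(`sum_mul_curv_of_covDeriv_eq`).  The twelve identities are the cases of this one, together with the
vanishing of the components `A¹_{11}`, `A¹_{12}`, `A¹_{22}` and `A²_{22}`
(`bracketCoef_one_of_vertical`, `bracketCoef_two_two`).

The commutator and the product rule are only available for differentiable coefficients, so the
second half of the argument is that the induced nonlinear connection and the induced tangent
connection are smooth on `W` (`indNonlin_isSmoothOn`, `contDiffOn_indLin`).  The fundamental tensor
is smooth and invertible where `y⁽¹⁾ ≠ 0`, the induced immersion of osculator bundles maps `W` into
this region because the differential of an immersion is injective, and the induced metric is
positive definite for the same reason; all other objects are obtained from these by differentiation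
and rational operations.
-/

namespace Osc2

/-! ### Smoothness of derivatives and of inverse matrices -/

theorem contDiffOn_fderiv_apply {E G : Type*} [NormedAddCommGroup E] [NormedSpace ℝ E]
    [NormedAddCommGroup G] [NormedSpace ℝ G] {S : Set E} (hS : IsOpen S) {f : E → G} {X : E → E}
    (hf : ContDiffOn ℝ ∞ f S) (hX : ContDiffOn ℝ ∞ X S) :
    ContDiffOn ℝ ∞ (fun q => fderiv ℝ f q (X q)) S :=
  (hf.fderiv_of_isOpen hS (m := ∞) le_rfl).clm_apply hX

theorem contDiffOn_matrix_det {E ι : Type*} [NormedAddCommGroup E] [NormedSpace ℝ E]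
    [Fintype ι] [DecidableEq ι] {S : Set E} {A : E → Matrix ι ι ℝ}
    (hA : ∀ a b, ContDiffOn ℝ ∞ (fun p => A p a b) S) :
    ContDiffOn ℝ ∞ (fun p => (A p).det) S := by
  simp only [Matrix.det_apply']
  exact ContDiffOn.sum fun σ _ => contDiffOn_const.mul (contDiffOn_prod fun c _ => hA _ _)

theorem contDiffOn_matrix_inv {E ι : Type*} [NormedAddCommGroup E] [NormedSpace ℝ E]
    [Fintype ι] [DecidableEq ι] {S : Set E} {A : E → Matrix ι ι ℝ}
    (hA : ∀ a b, ContDiffOn ℝ ∞ (fun p => A p a b) S) (hdet : ∀ p ∈ S, (A p).det ≠ 0) (a b : ι) :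
    ContDiffOn ℝ ∞ (fun p => (A p)⁻¹ a b) S := by
  simp only [Matrix.inv_def, Matrix.smul_apply, Ring.inverse_eq_inv', smul_eq_mul,
    Matrix.adjugate_apply]
  refine ((contDiffOn_matrix_det hA).inv hdet).mul (contDiffOn_matrix_det fun c d => ?_)
  by_cases h : c = b
  · subst h
    simpa using contDiffOn_const
  · simpa [Matrix.updateRow_ne h] using hA c d

theorem contDiffOn_coord {n : ℕ} (k : Fin 3) (a : Fin n) (S : Set (Coord n)) :
    ContDiffOn ℝ ∞ (fun p : Coord n => p k a) S :=
  ((contDiff_apply ℝ ℝ a).comp (contDiff_apply ℝ (Fin n → ℝ) k)).contDiffOn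

theorem contDiffOn_pd {n : ℕ} {S : Set (Coord n)} (hS : IsOpen S) {f : Coord n → ℝ}
    (hf : ContDiffOn ℝ ∞ f S) (k : Fin 3) (a : Fin n) : ContDiffOn ℝ ∞ (pd k a f) S :=
  contDiffOn_fderiv_apply hS hf contDiffOn_const

/-! ### Adapted frames of smooth nonlinear connections -/

namespace NonlinConn

variable {n : ℕ}

/-- The dual coefficients of the nonlinear connection are smooth on `S`. -/
structure IsSmoothOn (N : NonlinConn n) (S : Set (Coord n)) : Prop where
  M1 : ∀ a b, ContDiffOn ℝ ∞ (fun p => N.M1 p a b) S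
  M2 : ∀ a b, ContDiffOn ℝ ∞ (fun p => N.M2 p a b) S

variable {N : NonlinConn n} {S : Set (Coord n)}

theorem IsSmoothOn.frame (h : N.IsSmoothOn S) (k : Fin 3) (a : Fin n) :
    ContDiffOn ℝ ∞ (N.frame k a) S := by
  refine contDiffOn_pi.2 fun l => contDiffOn_pi.2 fun b => ?_
  have h1 := h.M1
  have h2 := h.M2
  fin_cases k <;> fin_cases l <;> simp only [NonlinConn.frame] <;>
    first
    | exact contDiffOn_const
    | exact (h1 b a).neg
    | exact (ContDiffOn.sum fun c _ => (h1 b c).mul (h1 c a)).sub (h2 b a)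

theorem IsSmoothOn.coframe {E : Type*} [NormedAddCommGroup E] [NormedSpace ℝ E] {T : Set E}
    (h : N.IsSmoothOn S) {f : E → Coord n} (hf : ContDiffOn ℝ ∞ f T) (hfS : Set.MapsTo f T S)
    {w : E → Coord n} (hw : ContDiffOn ℝ ∞ w T) (k : Fin 3) (a : Fin n) :
    ContDiffOn ℝ ∞ (fun p => N.coframe k a (f p) (w p)) T := by
  have hw' : ∀ l b, ContDiffOn ℝ ∞ (fun p => w p l b) T := fun l b =>
    contDiffOn_pi.1 (contDiffOn_pi.1 hw l) b
  have h1 : ∀ a b, ContDiffOn ℝ ∞ (fun p => N.M1 (f p) a b) T := fun a b =>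
    (h.M1 a b).comp hf hfS
  have h2 : ∀ a b, ContDiffOn ℝ ∞ (fun p => N.M2 (f p) a b) T := fun a b =>
    (h.M2 a b).comp hf hfS
  fin_cases k <;> simp only [NonlinConn.coframe]
  · exact hw' 0 a
  · exact (hw' 1 a).add (ContDiffOn.sum fun b _ => (h1 a b).mul (hw' 0 b))
  · exact ((hw' 2 a).add (ContDiffOn.sum fun b _ => (h1 a b).mul (hw' 1 b))).add
      (ContDiffOn.sum fun b _ => (h2 a b).mul (hw' 0 b))

theorem IsSmoothOn.fd (h : N.IsSmoothOn S) (hS : IsOpen S) {f : Coord n → ℝ}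
    (hf : ContDiffOn ℝ ∞ f S) (k : Fin 3) (a : Fin n) : ContDiffOn ℝ ∞ (N.fd k a f) S :=
  contDiffOn_fderiv_apply hS hf (h.frame k a)

theorem IsSmoothOn.bracketCoef (h : N.IsSmoothOn S) (hS : IsOpen S) (c k l : Fin 3)
    (s a b : Fin n) : ContDiffOn ℝ ∞ (N.bracketCoef c k l s a b) S :=
  h.coframe contDiffOn_id (fun _ hp => hp)
    ((contDiffOn_fderiv_apply hS (h.frame l b) (h.frame k a)).sub
      (contDiffOn_fderiv_apply hS (h.frame k a) (h.frame l b))) c s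

/-- The expansion of a tangent vector in the adapted frame, acting on a function. -/
theorem fderiv_eq_sum_fd (N : NonlinConn n) (f : Coord n → ℝ) (p w : Coord n) :
    fderiv ℝ f p w = ∑ k, ∑ a, N.coframe k a p w * N.fd k a f p := by
  have hw : w = ∑ k, ∑ a, N.coframe k a p w • N.frame k a p := by
    ext l b
    simp only [Finset.sum_apply, Pi.smul_apply, smul_eq_mul, Fin.sum_univ_three]
    fin_cases l
    · simp [coframe, frame, Pi.single_apply]
    · simp [coframe, frame, Pi.single_apply, mul_comm]
    · simp only [coframe, frame]
      simp [Pi.single_apply, add_mul, mul_sub, Finset.sum_add_distrib, Finset.sum_sub_distrib]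
      have : ∑ x, (∑ y, N.M1 p x y * w 0 y) * N.M1 p b x
          = ∑ x, w 0 x * ∑ y, N.M1 p b y * N.M1 p y x := by
        simp only [Finset.sum_mul, Finset.mul_sum]
        rw [Finset.sum_comm]
        exact Finset.sum_congr rfl fun _ _ => Finset.sum_congr rfl fun _ _ => by ring
      rw [this]
      simp only [mul_comm]
      ring
  conv_lhs => rw [hw]
  simp [NonlinConn.fd]

/-- The commutator of two fields of the adapted frame, expanded in that frame. -/
theorem fd_commutator (h : N.IsSmoothOn S) (hS : IsOpen S) {f : Coord n → ℝ}
    (hf : ContDiffOn ℝ ∞ f S) {p : Coord n} (hp : p ∈ S) (k l : Fin 3) (b c : Fin n) :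
    N.fd k b (N.fd l c f) p - N.fd l c (N.fd k b f) p
      = ∑ h, ∑ s, N.bracketCoef h k l s b c p * N.fd h s f p := by
  have hp' := hS.mem_nhds hp
  have key := VectorField.fderiv_apply_lieBracket (𝕜 := ℝ) (n := ∞) (hf.contDiffAt hp')
    (by rw [minSmoothness_of_isRCLikeNormedField]; exact WithTop.coe_le_coe.2 le_top)
    (((h.frame l c).contDiffAt hp').differentiableAt (by simp))
    (((h.frame k b).contDiffAt hp').differentiableAt (by simp))
  simp only [bracketCoef, ← N.fderiv_eq_sum_fd]
  exact key.symm

/-- The `dx`- and `dy⁽¹⁾`-components of the vertical fields `δ_{1a}` and `δ_{2a}` are constant, so a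
bracket of two of these fields has neither, and hence no `δ_{1s}`-component. -/
theorem bracketCoef_one_of_vertical (h : N.IsSmoothOn S) (hS : IsOpen S) {p : Coord n}
    (hp : p ∈ S) {k l : Fin 3} (hk : k ≠ 0) (hl : l ≠ 0) (s b c : Fin n) :
    N.bracketCoef 1 k l s b c p = 0 := by
  have hd : ∀ (k : Fin 3) a, DifferentiableAt ℝ (N.frame k a) p := fun k a =>
    ((h.frame k a).contDiffAt (hS.mem_nhds hp)).differentiableAt (by simp)
  have hc : ∀ (k : Fin 3), k ≠ 0 → ∀ a j, j ≠ 2 → ∀ e w, fderiv ℝ (N.frame k a) p w j e = 0 := by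
    intro k hk a j hj e w
    have h1 : fderiv ℝ (N.frame k a) p w j e = fderiv ℝ (fun q => N.frame k a q j e) p w := by
      have := ((hasFDerivAt_pi'.1 (hasFDerivAt_pi'.1 (hd k a).hasFDerivAt j)) e).fderiv
      rw [this]; rfl
    rw [h1]
    fin_cases k <;> fin_cases j <;> simp_all [NonlinConn.frame]
  simp [bracketCoef, coframe, VectorField.lieBracket, hc k hk _ _ _ _ _, hc l hl _ _ _ _ _]

theorem bracketCoef_two_two (N : NonlinConn n) (h : Fin 3) (s b c : Fin n) (p : Coord n) :
    N.bracketCoef h 2 2 s b c p = 0 := by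
  have hc : ∀ a, fderiv ℝ (N.frame 2 a) p = 0 := fun a =>
    fderiv_const_apply (![0, 0, Pi.single a 1] : Coord n)
  fin_cases h <;> simp [bracketCoef, coframe, VectorField.lieBracket, hc]

end NonlinConn

/-! ### The Ricci identity for a d-vector field with constant deflection -/

/-- If the covariant derivatives of `z` are constant multiples of the identity, then its derivatives
along the adapted frame are `const - z · D`; this differentiates them by the product rule. -/
theorem fd_fd_of_covDeriv_eq {n : ℕ} {N : NonlinConn n} {D : LinConn n} {W : Set (Coord n)}
    (hW : IsOpen W) {i : Fin 3} (hD : ∀ k a b d, ContDiffOn ℝ ∞ (D i k a b d) W)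
    {z : Fin n → Coord n → ℝ} (hz : ∀ a, ContDiffOn ℝ ∞ (z a) W) {c : Fin 3 → ℝ}
    (hc : ∀ k, ∀ p ∈ W, ∀ a b, covDeriv N D i k z a b p = if a = b then c k else 0)
    {p : Coord n} (hp : p ∈ W) (k l : Fin 3) (a b e : Fin n) :
    N.fd k b (N.fd l e (z a)) p
      = -∑ d, (N.fd k b (z d) p * D i l a d e p + z d p * N.fd k b (D i l a d e) p) := by
  have hp' := hW.mem_nhds hp
  have heq : N.fd l e (z a) =ᶠ[nhds p]
      fun q => (if a = e then c l else 0) - ∑ d, z d q * D i l a d e q := by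
    filter_upwards [hp'] with q hq
    rw [← hc l q hq a e, covDeriv, add_sub_cancel_right]
  have hz' : ∀ d, DifferentiableAt ℝ (z d) p := fun d =>
    ((hz d).contDiffAt hp').differentiableAt (by simp)
  have hD' : ∀ d, DifferentiableAt ℝ (D i l a d e) p := fun d =>
    ((hD l a d e).contDiffAt hp').differentiableAt (by simp)
  have hder := (HasFDerivAt.fun_sum (u := Finset.univ) fun d _ =>
    (hz' d).hasFDerivAt.fun_mul (hD' d).hasFDerivAt).const_sub (if a = e then c l else 0)
  unfold NonlinConn.fd at heq ⊢
  rw [heq.fderiv_eq, hder.fderiv]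
  simp only [neg_apply, sum_apply, add_apply, smul_apply, smul_eq_mul]
  congr 1
  exact Finset.sum_congr rfl fun d _ => by ring

/-- The Ricci identity applied to a d-vector field `z` whose covariant derivative in the direction
of the `k`-th distribution is `c k` times the identity: the second covariant derivatives of `z`
involve only the connection coefficients, so the curvature, contracted with `z`, reduces to the
torsion. -/
theorem sum_mul_curv_of_covDeriv_eq {n : ℕ} {N : NonlinConn n} {D : LinConn n}
    {W : Set (Coord n)} (hW : IsOpen W) (hN : N.IsSmoothOn W) {i : Fin 3}
    (hD : ∀ k a b d, ContDiffOn ℝ ∞ (D i k a b d) W)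
    {z : Fin n → Coord n → ℝ} (hz : ∀ a, ContDiffOn ℝ ∞ (z a) W) {c : Fin 3 → ℝ}
    (hc : ∀ k, ∀ p ∈ W, ∀ a b, covDeriv N D i k z a b p = if a = b then c k else 0)
    {p : Coord n} (hp : p ∈ W) (k l : Fin 3) (a b e : Fin n) :
    ∑ d, z d p * curv N D i k l d a b e p
      = ∑ h, c h * N.bracketCoef h k l a b e p + c k * D i l a b e p - c l * D i k a e b p := by
  have hfd : ∀ k a b, N.fd k b (z a) p = (if a = b then c k else 0) - ∑ d, z d p * D i k a d b p :=
    fun k a b => by rw [← hc k p hp a b, covDeriv, add_sub_cancel_right]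
  have hcomm := N.fd_commutator hN hW (hz a) hp k l b e
  rw [fd_fd_of_covDeriv_eq hW hD hz hc hp, fd_fd_of_covDeriv_eq hW hD hz hc hp] at hcomm
  simp only [hfd, sub_mul, mul_sub, ite_mul, mul_ite, zero_mul, mul_zero, Finset.sum_add_distrib,
    Finset.sum_sub_distrib, Finset.sum_ite_eq, Finset.sum_ite_eq', Finset.mem_univ,
    if_true] at hcomm
  -- The products of two connection coefficients become the quadratic terms of the curvature.
  have hA : ∀ k l b e, ∑ d, (∑ d', z d' p * D i k d d' b p) * D i l a d e p
      = ∑ d, z d p * ∑ d', D i k d' d b p * D i l a d' e p := by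
    intro k l b e
    simp only [Finset.sum_mul, Finset.mul_sum]
    rw [Finset.sum_comm]
    exact Finset.sum_congr rfl fun _ _ => Finset.sum_congr rfl fun _ _ => by ring
  have hB : ∑ h, ∑ s, N.bracketCoef h k l s b e p * ∑ d, z d p * D i h a d s p
      = ∑ d, z d p * ∑ h, ∑ s, D i h a d s p * N.bracketCoef h k l s b e p := by
    simp only [Finset.mul_sum]
    rw [Finset.sum_comm (s := (Finset.univ : Finset (Fin n))) (t := (Finset.univ : Finset (Fin 3)))]
    refine Finset.sum_congr rfl fun _ _ => ?_
    rw [Finset.sum_comm]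
    exact Finset.sum_congr rfl fun _ _ => Finset.sum_congr rfl fun _ _ => by ring
  rw [hA, hA, hB] at hcomm
  simp only [curv, mul_add, mul_sub, Finset.sum_add_distrib, Finset.sum_sub_distrib]
  simp only [mul_comm (N.bracketCoef _ _ _ _ _ _ _) (c _)] at hcomm
  linear_combination hcomm

/-! ### Smoothness of the canonical connections of a Finsler space -/

section Finsler

variable {n : ℕ} {F : (Fin n → ℝ) → (Fin n → ℝ) → ℝ} {U : Set (Fin n → ℝ)}

/-- The part of the osculator bundle over `U` where `y⁽¹⁾` does not vanish; the objects built from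
a Finsler fundamental function are smooth there. -/
def slitDomain (U : Set (Fin n → ℝ)) : Set (Coord n) := {p | p 0 ∈ U ∧ p 1 ≠ 0}

theorem isOpen_slitDomain (hU : IsOpen U) : IsOpen (slitDomain U) :=
  (hU.preimage (continuous_apply 0)).inter (isOpen_ne.preimage (continuous_apply 1))

namespace IsFinsler

theorem contDiffOn_fundTensor (hF : IsFinsler F U) (hU : IsOpen U) (a b : Fin n) :
    ContDiffOn ℝ ∞ (fun p => fundTensor F p a b) (slitDomain U) := by
  have h : ContDiffOn ℝ ∞ (fun q : Coord n => F (q 0) (q 1) ^ 2) (slitDomain U) :=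
    (hF.smooth.comp ((contDiff_apply ℝ (Fin n → ℝ) (0 : Fin 3)).prodMk
      (contDiff_apply ℝ (Fin n → ℝ) (1 : Fin 3))).contDiffOn fun p hp => hp).pow 2
  have hS := isOpen_slitDomain hU
  exact contDiffOn_const.mul (contDiffOn_pd hS (contDiffOn_pd hS h 1 b) 1 a)

theorem contDiffOn_fundTensor_inv (hF : IsFinsler F U) (hU : IsOpen U) (a b : Fin n) :
    ContDiffOn ℝ ∞ (fun p => (fundTensor F p)⁻¹ a b) (slitDomain U) :=
  contDiffOn_matrix_inv (hF.contDiffOn_fundTensor hU)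
    (fun p hp => (hF.posDef p hp.1 hp.2).det_pos.ne') a b

theorem contDiffOn_canM1 (hF : IsFinsler F U) (hU : IsOpen U) (a b : Fin n) :
    ContDiffOn ℝ ∞ (fun p => canM1 F p a b) (slitDomain U) := by
  have hS := isOpen_slitDomain hU
  have hg := hF.contDiffOn_fundTensor hU
  have hγ : ∀ a b c, ContDiffOn ℝ ∞ (christoffel F a b c) (slitDomain U) := fun a b c =>
    contDiffOn_const.mul (ContDiffOn.sum fun d _ => (hF.contDiffOn_fundTensor_inv hU a d).mul
      (((contDiffOn_pd hS (hg d c) 0 b).add (contDiffOn_pd hS (hg b d) 0 c)).sub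
        (contDiffOn_pd hS (hg b c) 0 d)))
  have hG : ContDiffOn ℝ ∞ (spray F a) (slitDomain U) :=
    contDiffOn_const.mul (ContDiffOn.sum fun b _ => ContDiffOn.sum fun c _ =>
      ((hγ a b c).mul (contDiffOn_coord 1 b _)).mul (contDiffOn_coord 1 c _))
  exact contDiffOn_pd hS hG 1 b

theorem canNonlin_isSmoothOn (hF : IsFinsler F U) (hU : IsOpen U) :
    (canNonlin F).IsSmoothOn (slitDomain U) := by
  have hS := isOpen_slitDomain hU
  have h1 := hF.contDiffOn_canM1 hU
  refine ⟨h1, fun a b => contDiffOn_const.mul (ContDiffOn.add ?_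
    (ContDiffOn.sum fun d _ => (h1 a d).mul (h1 d b)))⟩
  exact ContDiffOn.sum fun d _ =>
    ((contDiffOn_coord 1 d _).mul (contDiffOn_pd hS (h1 a b) 0 d)).add
      ((contDiffOn_const.mul (contDiffOn_coord 2 d _)).mul (contDiffOn_pd hS (h1 a b) 1 d))

theorem contDiffOn_canLin (hF : IsFinsler F U) (hU : IsOpen U) (i k : Fin 3) (a b c : Fin n) :
    ContDiffOn ℝ ∞ (canLin F i k a b c) (slitDomain U) := by
  have hS := isOpen_slitDomain hU
  have hN := hF.canNonlin_isSmoothOn hU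
  have hg := hF.contDiffOn_fundTensor hU
  have hgi := hF.contDiffOn_fundTensor_inv hU
  have hB : ∀ a c b, ContDiffOn ℝ ∞ (Bjj F i a c b) (slitDomain U) := fun a c b =>
    hN.bracketCoef hS i 0 i a c b
  unfold canLin
  split_ifs
  · exact contDiffOn_const.mul (ContDiffOn.sum fun d _ => (hgi a d).mul
      (((hN.fd hS (hg d c) k b).add (hN.fd hS (hg b d) k c)).sub (hN.fd hS (hg b c) k d)))
  · exact (hB a c b).add (contDiffOn_const.mul (ContDiffOn.sum fun d _ => (hgi a d).mul
      (((hN.fd hS (hg b d) 0 c).sub (ContDiffOn.sum fun f _ => (hB f c b).mul (hg f d))).sub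
        (ContDiffOn.sum fun f _ => (hB f c d).mul (hg b f)))))
  · exact contDiffOn_const.mul (ContDiffOn.sum fun d _ => (hgi a d).mul (hN.fd hS (hg b d) k c))

end IsFinsler

end Finsler

/-! ### Smoothness of the induced connections of a submanifold -/

section Submanifold

variable {n m : ℕ} {F : (Fin n → ℝ) → (Fin n → ℝ) → ℝ} {U : Set (Fin n → ℝ)}
  {x : (Fin m → ℝ) → (Fin n → ℝ)} {V : Set (Fin m → ℝ)} {W : Set (Coord m)}
  {E : Fin (n - m) → Fin n → Coord m → ℝ}

theorem sum_tanB_mul (x : (Fin m → ℝ) → (Fin n → ℝ)) (u v : Fin m → ℝ) (a : Fin n) :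
    ∑ α, tanB x a α u * v α = fderiv ℝ x u v a := by
  conv_rhs => rw [← ContinuousLinearMap.coe_coe, LinearMap.pi_apply_eq_sum_univ]
  simp only [Finset.sum_apply, Pi.smul_apply, smul_eq_mul, tanB, ContinuousLinearMap.coe_coe]
  refine Finset.sum_congr rfl fun α _ => ?_
  have hα : (Pi.single α 1 : Fin m → ℝ) = fun j => if α = j then 1 else 0 := by
    ext j
    simp [Pi.single_apply, eq_comm]
  rw [hα, mul_comm]

/-- The data of an immersed submanifold of a Finsler space, over a chart: `x` is a smooth
immersion of `V` into `U`, and `W` is an open part of the osculator bundle over `V` on which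
`v⁽¹⁾` does not vanish. -/
structure IsImmersedOn (x : (Fin m → ℝ) → (Fin n → ℝ)) (V : Set (Fin m → ℝ))
    (U : Set (Fin n → ℝ)) (W : Set (Coord m)) : Prop where
  isOpen_source : IsOpen V
  contDiffOn : ContDiffOn ℝ ∞ x V
  mapsTo : Set.MapsTo x V U
  injective : ∀ u ∈ V, Function.Injective (fderiv ℝ x u)
  isOpen : IsOpen W
  subset : W ⊆ slitDomain V

namespace IsImmersedOn

theorem contDiffOn_tanB (h : IsImmersedOn x V U W) (a : Fin n) (α : Fin m) :
    ContDiffOn ℝ ∞ (fun p : Coord m => tanB x a α (p 0)) W :=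
  (contDiffOn_pi.1 (contDiffOn_fderiv_apply h.isOpen_source h.contDiffOn
    (contDiffOn_const (c := Pi.single α 1))) a).comp
      (contDiff_apply ℝ (Fin m → ℝ) (0 : Fin 3)).contDiffOn fun _ hp => (h.subset hp).1

theorem contDiffOn_tanB2 (h : IsImmersedOn x V U W) (a : Fin n) (α β : Fin m) :
    ContDiffOn ℝ ∞ (fun p : Coord m => tanB2 x a α β (p 0)) W :=
  (contDiffOn_fderiv_apply h.isOpen_source (contDiffOn_pi.1
    (contDiffOn_fderiv_apply h.isOpen_source h.contDiffOn
      (contDiffOn_const (c := Pi.single α 1))) a) (contDiffOn_const (c := Pi.single β 1))).comp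
      (contDiff_apply ℝ (Fin m → ℝ) (0 : Fin 3)).contDiffOn fun _ hp => (h.subset hp).1

theorem contDiffOn_osc (h : IsImmersedOn x V U W) : ContDiffOn ℝ ∞ (osc x) W := by
  refine contDiffOn_pi.2 fun k => contDiffOn_pi.2 fun a => ?_
  fin_cases k
  · exact contDiffOn_pi.1 (h.contDiffOn.comp
      (contDiff_apply ℝ (Fin m → ℝ) (0 : Fin 3)).contDiffOn fun _ hp => (h.subset hp).1) a
  · change ContDiffOn ℝ ∞ (fun p => ∑ α, tanB x a α (p 0) * p 1 α) W
    exact ContDiffOn.sum fun α _ => (h.contDiffOn_tanB a α).mul (contDiffOn_coord 1 α W)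
  · exact (contDiffOn_const.mul (ContDiffOn.sum fun α _ => ContDiffOn.sum fun β _ =>
      ((h.contDiffOn_tanB2 a α β).mul (contDiffOn_coord 1 α W)).mul
        (contDiffOn_coord 1 β W))).add
      (ContDiffOn.sum fun α _ => (h.contDiffOn_tanB a α).mul (contDiffOn_coord 2 α W))

/-- Since `y⁽¹⁾` is the image of `v⁽¹⁾ ≠ 0` under the differential of an immersion, it does not
vanish. -/
theorem mapsTo_osc (h : IsImmersedOn x V U W) : Set.MapsTo (osc x) W (slitDomain U) := by
  intro p hp
  refine ⟨h.mapsTo (h.subset hp).1, fun h0 => (h.subset hp).2 ?_⟩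
  refine h.injective (p 0) (h.subset hp).1 ?_
  rw [map_zero]
  ext a
  rw [← sum_tanB_mul]
  exact congrFun h0 a

theorem contDiffOn_comp_osc (h : IsImmersedOn x V U W) {f : Coord n → ℝ}
    (hf : ContDiffOn ℝ ∞ f (slitDomain U)) : ContDiffOn ℝ ∞ (fun p => f (osc x p)) W :=
  hf.comp h.contDiffOn_osc h.mapsTo_osc

/-- The induced metric is `Bᵀ g B`, where `B`, the Jacobian matrix of the immersion, is injective. -/
theorem posDef_indMetric (h : IsImmersedOn x V U W) (hF : IsFinsler F U) {p : Coord m}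
    (hp : p ∈ W) : (indMetric F x p).PosDef := by
  have hosc := h.mapsTo_osc hp
  let B : Matrix (Fin n) (Fin m) ℝ := Matrix.of fun a α => tanB x a α (p 0)
  have hB : Function.Injective B.mulVec := fun v w hvw =>
    h.injective (p 0) (h.subset hp).1 <| by
      ext a
      rw [← sum_tanB_mul, ← sum_tanB_mul]
      exact congrFun hvw a
  have := (hF.posDef _ hosc.1 hosc.2).conjTranspose_mul_mul_same hB
  convert this using 1
  ext α β
  simp only [indMetric, Matrix.of_apply, Matrix.mul_apply, Matrix.conjTranspose_apply, B,
    star_trivial, Finset.sum_mul]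
  rw [Finset.sum_comm]
  exact Finset.sum_congr rfl fun _ _ => Finset.sum_congr rfl fun _ _ => by ring

theorem contDiffOn_cotanB (h : IsImmersedOn x V U W) (hF : IsFinsler F U) (hU : IsOpen U)
    (α : Fin m) (a : Fin n) : ContDiffOn ℝ ∞ (cotanB F x α a) W := by
  have hg : ∀ a b, ContDiffOn ℝ ∞ (fun p => fundTensor F (osc x p) a b) W := fun a b =>
    h.contDiffOn_comp_osc (hF.contDiffOn_fundTensor hU a b)
  have hind : ∀ α β, ContDiffOn ℝ ∞ (fun p => indMetric F x p α β) W := fun α β => by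
    simp only [indMetric, Matrix.of_apply]
    exact ContDiffOn.sum fun a _ => ContDiffOn.sum fun b _ =>
      ((hg a b).mul (h.contDiffOn_tanB a α)).mul (h.contDiffOn_tanB b β)
  have hinv : ∀ α β, ContDiffOn ℝ ∞ (fun p => (indMetric F x p)⁻¹ α β) W :=
    contDiffOn_matrix_inv hind fun p hp => (h.posDef_indMetric hF hp).det_pos.ne'
  exact ContDiffOn.sum fun β _ => ContDiffOn.sum fun b _ =>
    ((hinv α β).mul (hg a b)).mul (h.contDiffOn_tanB b β)

theorem contDiffOn_pullCoframe (h : IsImmersedOn x V U W) (hF : IsFinsler F U) (hU : IsOpen U)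
    (k : Fin 3) (a : Fin n) {w : Coord m → Coord m} (hw : ContDiffOn ℝ ∞ w W) :
    ContDiffOn ℝ ∞ (fun p => pullCoframe F x k a p (w p)) W :=
  (hF.canNonlin_isSmoothOn hU).coframe h.contDiffOn_osc h.mapsTo_osc
    (contDiffOn_fderiv_apply h.isOpen h.contDiffOn_osc hw) k a

theorem indNonlin_isSmoothOn (h : IsImmersedOn x V U W) (hF : IsFinsler F U) (hU : IsOpen U) :
    (indNonlin F x).IsSmoothOn W where
  M1 α _ := by
    simp only [indNonlin]
    exact ContDiffOn.sum fun a _ => (h.contDiffOn_cotanB hF hU α a).mul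
      (h.contDiffOn_pullCoframe hF hU 1 a contDiffOn_const)
  M2 α _ := by
    simp only [indNonlin]
    exact ContDiffOn.sum fun a _ => (h.contDiffOn_cotanB hF hU α a).mul
      (h.contDiffOn_pullCoframe hF hU 2 a contDiffOn_const)

theorem contDiffOn_mixedK (h : IsImmersedOn x V U W) (hF : IsFinsler F U) (hU : IsOpen U)
    (hE : IsNormalFrame F x W E) (j : Fin 3) (ν : Fin (n - m)) (β : Fin m) :
    ContDiffOn ℝ ∞ (mixedK F x E j ν β) W :=
  ContDiffOn.sum fun a _ =>
    (ContDiffOn.sum fun b _ =>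
      (h.contDiffOn_comp_osc (hF.contDiffOn_fundTensor hU a b)).mul (hE.smooth ν b)).mul
    (h.contDiffOn_pullCoframe hF hU j a ((h.indNonlin_isSmoothOn hF hU).frame 0 β))

theorem contDiffOn_coupling (h : IsImmersedOn x V U W) (hF : IsFinsler F U) (hU : IsOpen U)
    (hE : IsNormalFrame F x W E) (i k : Fin 3) (a b : Fin n) (δ : Fin m) :
    ContDiffOn ℝ ∞ (coupling F x E i k a b δ) W := by
  have hΓ : ∀ k a b c, ContDiffOn ℝ ∞ (fun p => canLin F i k a b c (osc x p)) W :=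
    fun k a b c => h.contDiffOn_comp_osc (hF.contDiffOn_canLin hU i k a b c)
  have hT : ∀ k, ContDiffOn ℝ ∞
      (fun p => ∑ d, canLin F i k a b d (osc x p) * tanB x d δ (p 0)) W := fun k =>
    ContDiffOn.sum fun d _ => (hΓ k a b d).mul (h.contDiffOn_tanB d δ)
  have hK : ∀ k j, ContDiffOn ℝ ∞ (fun p => ∑ d, ∑ ν,
      canLin F i k a b d (osc x p) * E ν d p * mixedK F x E j ν δ p) W := fun k j =>
    ContDiffOn.sum fun d _ => ContDiffOn.sum fun ν _ =>
      ((hΓ k a b d).mul (hE.smooth ν d)).mul (h.contDiffOn_mixedK hF hU hE j ν δ)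
  fin_cases k
  · exact ((hT 0).add (hK 1 1)).add (hK 2 2)
  · exact (hT 1).add (hK 2 1)
  · exact hT 2

theorem contDiffOn_indLin (h : IsImmersedOn x V U W) (hF : IsFinsler F U) (hU : IsOpen U)
    (hE : IsNormalFrame F x W E) (i k : Fin 3) (α β δ : Fin m) :
    ContDiffOn ℝ ∞ (indLin F x E i k α β δ) W := by
  refine ContDiffOn.sum fun d _ => (h.contDiffOn_cotanB hF hU α d).mul (ContDiffOn.add ?_
    (ContDiffOn.sum fun f _ =>
      (h.contDiffOn_tanB f β).mul (h.contDiffOn_coupling hF hU hE i k d f δ)))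
  split_ifs
  · exact h.contDiffOn_tanB2 d β δ
  · exact contDiffOn_const

end IsImmersedOn

end Submanifold

end Osc2

/-! ### The identities for the Liouville d-vector fields -/

theorem proposition5p2 {n m : ℕ} (hm : 1 < m) (hmn : m < n)
    -- a Finsler space, over the coordinate domain `U` of the ambient manifold
    (U : Set (Fin n → ℝ)) (hU : IsOpen U)
    (F : (Fin n → ℝ) → (Fin n → ℝ) → ℝ) (hF : Osc2.IsFinsler F U)
    -- the immersed submanifold, over the coordinate domain `V`
    (V : Set (Fin m → ℝ)) (hV : IsOpen V)
    (x : (Fin m → ℝ) → (Fin n → ℝ)) (hx : ContDiffOn ℝ ∞ x V) (hxU : Set.MapsTo x V U)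
    (himm : ∀ u ∈ V, Function.Injective (fderiv ℝ x u))
    -- an open set of points `(u, v⁽¹⁾, v⁽²⁾)` with `v⁽¹⁾ ≠ 0`, and a normal frame on it
    (W : Set (Osc2.Coord m)) (hW : IsOpen W) (hWV : ∀ p ∈ W, p 0 ∈ V ∧ p 1 ≠ 0)
    (E : Fin (n - m) → Fin n → Osc2.Coord m → ℝ) (hE : Osc2.IsNormalFrame F x W E)
    -- the induced nonlinear connection and the induced tangent N-linear connection
    (N : Osc2.NonlinConn m) (hN : N = Osc2.indNonlin F x)
    (D : Osc2.LinConn m) (hD : D = Osc2.indLin F x E)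
    (i : Fin 3)
    -- the deflection tensors have the special form
    (hD1 : ∀ p ∈ W, ∀ α β,
      Osc2.covDeriv N D i 0 Osc2.z1 α β p = 0)
    (hd11 : ∀ p ∈ W, ∀ α β,
      Osc2.covDeriv N D i 1 Osc2.z1 α β p = if α = β then 1 else 0)
    (hd12 : ∀ p ∈ W, ∀ α β,
      Osc2.covDeriv N D i 2 Osc2.z1 α β p = 0)
    (hD2 : ∀ p ∈ W, ∀ α β,
      Osc2.covDeriv N D i 0 (Osc2.z2 N) α β p = 0)
    (hd21 : ∀ p ∈ W, ∀ α β,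
      Osc2.covDeriv N D i 1 (Osc2.z2 N) α β p = 0)
    (hd22 : ∀ p ∈ W, ∀ α β,
      Osc2.covDeriv N D i 2 (Osc2.z2 N) α β p = if α = β then 1 else 0) :
    ∀ p ∈ W, ∀ α β γ : Fin m,
      -- the contractions of `R`
      (∑ δ, Osc2.z1 δ p * Osc2.curvR N D i δ α β γ p = Osc2.torsR0 N 1 α β γ p) ∧
      (∑ δ, Osc2.z2 N δ p * Osc2.curvR N D i δ α β γ p = Osc2.torsR0 N 2 α β γ p) ∧
      -- the contractions of `P`
      (∑ δ, Osc2.z1 δ p * Osc2.curvP N D 2 i δ α β γ p = Osc2.torsP21 N α β γ p) ∧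
      (∑ δ, Osc2.z2 N δ p * Osc2.curvP N D 1 i δ α β γ p = Osc2.torsP12 N α β γ p) ∧
      (∑ δ, Osc2.z1 δ p * Osc2.curvP N D 1 i δ α β γ p = Osc2.torsP N D 1 i α β γ p) ∧
      (∑ δ, Osc2.z2 N δ p * Osc2.curvP N D 2 i δ α β γ p = Osc2.torsP N D 2 i α β γ p) ∧
      -- the contractions of `Q`
      (∑ δ, Osc2.z1 δ p * Osc2.curvQ N D i δ α β γ p = D i 2 α β γ p) ∧
      (∑ δ, Osc2.z2 N δ p * Osc2.curvQ N D i δ α β γ p = Osc2.torsQ22 N D i α β γ p) ∧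
      -- the contractions of `S`
      (∑ δ, Osc2.z1 δ p * Osc2.curvS N D 1 i δ α β γ p = Osc2.torsS D 1 i α β γ p) ∧
      (∑ δ, Osc2.z2 N δ p * Osc2.curvS N D 2 i δ α β γ p = Osc2.torsS D 2 i α β γ p) ∧
      (∑ δ, Osc2.z1 δ p * Osc2.curvS N D 2 i δ α β γ p = 0) ∧
      (∑ δ, Osc2.z2 N δ p * Osc2.curvS N D 1 i δ α β γ p = Osc2.torsR12 N α β γ p) := by
  subst hN hD
  have him : Osc2.IsImmersedOn x V U W := ⟨hV, hx, hxU, himm, hW, hWV⟩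
  have hN := him.indNonlin_isSmoothOn hF hU
  have hz1 : ∀ a, ContDiffOn ℝ ∞ (Osc2.z1 (n := m) a) W := fun a => Osc2.contDiffOn_coord 1 a W
  have hz2 : ∀ a, ContDiffOn ℝ ∞ (Osc2.z2 (Osc2.indNonlin F x) a) W := fun a =>
    (Osc2.contDiffOn_coord 2 a W).add (contDiffOn_const.mul (ContDiffOn.sum fun b _ =>
      (hN.M1 a b).mul (Osc2.contDiffOn_coord 1 b W)))
  have hc1 : ∀ k, ∀ p ∈ W, ∀ a b,
      Osc2.covDeriv (Osc2.indNonlin F x) (Osc2.indLin F x E) i k Osc2.z1 a b p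
        = if a = b then (![0, 1, 0] : Fin 3 → ℝ) k else 0 := by
    intro k p hp a b
    fin_cases k
    · simpa using hD1 p hp a b
    · simpa using hd11 p hp a b
    · simpa using hd12 p hp a b
  have hc2 : ∀ k, ∀ p ∈ W, ∀ a b,
      Osc2.covDeriv (Osc2.indNonlin F x) (Osc2.indLin F x E) i k
        (Osc2.z2 (Osc2.indNonlin F x)) a b p
        = if a = b then (![0, 0, 1] : Fin 3 → ℝ) k else 0 := by
    intro k p hp a b
    fin_cases k
    · simpa using hD2 p hp a b
    · simpa using hd21 p hp a b
    · simpa using hd22 p hp a b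
  intro p hp a b e
  have hΓ := him.contDiffOn_indLin hF hU hE i
  have R1 := fun k l => Osc2.sum_mul_curv_of_covDeriv_eq hW hN hΓ hz1 hc1 hp k l a b e
  have R2 := fun k l => Osc2.sum_mul_curv_of_covDeriv_eq hW hN hΓ hz2 hc2 hp k l a b e
  have hA1 : ∀ k l : Fin 3, k ≠ 0 → l ≠ 0 →
      (Osc2.indNonlin F x).bracketCoef 1 k l a b e p = 0 := fun k l hk hl =>
    Osc2.NonlinConn.bracketCoef_one_of_vertical hN hW hp hk hl a b e
  have hA2 := (Osc2.indNonlin F x).bracketCoef_two_two 2 a b e p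
  simp only [Osc2.curvR, Osc2.curvP, Osc2.curvQ, Osc2.curvS, R1, R2, Fin.sum_univ_three,
    Osc2.torsR0, Osc2.torsR12, Osc2.torsP12, Osc2.torsP21, Osc2.torsP, Osc2.torsQ22, Osc2.torsS]
  simp [hA1, hA2]
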